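/- All graphs are finite and simple. For $\ell\ge 1$, an $\ell$-partite graph is a graph $G$ together with a partition of its vertex set into nonempty independent sets $V_1,\dots,V_\ell$; for $i\neq j$ the density between two parts is $$d(V_i,V_j)=\frac{e(V_i,V_j)}{|V_i|\,|V_j|},$$ where $e(V_i,V_j)$ is the number of edges of $G$ between $V_i$ and $V_j$. The parts need not have equal sizes. For integers $k\ge 2$ and $\ell\ge k$, let $d^k_\ell$ be the minimum real number $d$ such that every $\ell$-partite graph with $d(V_i,V_j)>d$ for all $1\le i<j\le \ell$ contains a complete graph $K^k$ on $k$ vertices as a subgraph. Then for every integer $k\ge 2$ there is an $L=L(k)$ such that for all $\ell\ge L$ the minimum $d^k_\ell$ exists and $$d^k_\ell=\frac{k-2}{k-1}.$$ -/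

import Mathlib

/-- The `i`-th part `V_i` of an `ℓ`-partite graph, whose partition is given by a proper
colouring `C` of its vertices with the colours `Fin ℓ`. -/
def partOf {V : Type*} [Fintype V] {G : SimpleGraph V} {ℓ : ℕ} (C : G.Coloring (Fin ℓ))
    (i : Fin ℓ) : Finset V :=
  {v : V | C v = i}

/-- The density `d(V_i, V_j)` of two parts of an `ℓ`-partite graph. As `V_i` and `V_j` are
disjoint independent sets for `i ≠ j`, the number of edges between them is the number of edges
of the graph induced on `V_i ∪ V_j`. -/
def partDensity {V : Type*} [Fintype V] {G : SimpleGraph V} [DecidableRel G.Adj]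
    {ℓ : ℕ} (C : G.Coloring (Fin ℓ)) (i j : Fin ℓ) : ℝ :=
  (G.edgeDensity (partOf C i) (partOf C j) : ℝ)

/-- The real number `d` forces `H` in `ℓ`-partite graphs: every finite `ℓ`-partite graph with
nonempty parts, all of whose pairwise part densities are greater than `d`, contains a
(not necessarily induced) copy of `H`. -/
def ForcesInPartite {W : Type*} (H : SimpleGraph W) (ℓ : ℕ) (d : ℝ) : Prop :=
  ∀ (V : Type) [Fintype V] (G : SimpleGraph V) [DecidableRel G.Adj]
    (C : G.Coloring (Fin ℓ)), (∀ i, (partOf C i).Nonempty) →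
    (∀ i j : Fin ℓ, i < j → d < partDensity C i j) → H.IsContained G

/-- `d_ℓ(H) = d`: the number `d` is the minimum of all reals that force `H` in `ℓ`-partite
graphs. -/
def IsCriticalDensity {W : Type*} (H : SimpleGraph W) (ℓ : ℕ) (d : ℝ) : Prop :=
  IsLeast {x : ℝ | ForcesInPartite H ℓ x} d

/-!
Write `k = r + 1`. The tensor product of `K_ℓ` and `K_r` has all densities equal to `1 - 1 / r` and
is `r`-colourable, so nothing below `1 - 1 / r` forces `K_{r+1}`.

For the converse let `G` be free of `K_{r+1}` with many parts, all densities greater than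
`1 - 1 / r`, and give every part total weight `1`, spread uniformly. The edge weight of `G` is then
so close to the bound of Turán's theorem (`weighted_turan`) that `G` is almost a Turán graph: there
is a partition into `r` classes such that no two adjacent vertices of large degree lie in the same
class, and no degree is much above the average (`exists_coloring_of_dense`). The remaining
"exceptional" vertices have degree smaller than the average by a constant proportion, and therefore
small total weight (`sum_weight_le_of_small_degree`).

If there were no exceptional vertices, the class weights of part `i` would be `1 / r` plus a vector
`q i` with coordinate sum `0`, and the density of parts `i` and `j` would be at most
`1 - 1 / r - ⟪q i, q j⟫`. All inner products `⟪q i, q j⟫` would be negative, which is impossible for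
many vectors in a space of fixed dimension. With exceptional vertices single inner products may be
slightly positive, and only sums over many pairs of parts are controlled. The key fact is that after
discarding a small proportion of the parts the inner products over all remaining pairs have
nonnegative sum (`exists_large_subset_sum_offDiag_inner_nonneg`). Since so few parts are discarded,
the exceptional vertices still have too small a degree into the remaining ones. Summation of the
densities over the remaining pairs contradicts the assumption (`exists_pair_density_le`).
-/

/-! ### Sums of inner products of many vectors in a space of fixed dimension -/

/-- Nonzero vectors are coloured by a finite cover of the unit sphere by balls of radius `1 / 2`, so
that vectors of the same colour enclose an angle of at most `60°`. -/
theorem exists_finite_direction_coloring (E : Type*) [NormedAddCommGroup E]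
    [InnerProductSpace ℝ E] [FiniteDimensional ℝ E] :
    ∃ (T : ℕ) (col : E → Fin (T + 1)), ∀ a b : E, col a = col b →
      1 / 2 * (‖a‖ * ‖b‖) ≤ inner ℝ a b := by
  classical
  have : ProperSpace E := FiniteDimensional.proper ℝ E
  obtain ⟨t, ht, htf, hcov⟩ :=
    (isCompact_sphere (0 : E) 1).finite_cover_balls (e := 1 / 2) (by norm_num)
  have hex : ∀ a : E, ∃ x : E, a ≠ 0 → x ∈ t ∧ ‖‖a‖⁻¹ • a - x‖ < 1 / 2 := by
    intro a
    by_cases ha : a = 0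
    · exact ⟨0, fun h => (h ha).elim⟩
    have hu : ‖a‖⁻¹ • a ∈ Metric.sphere (0 : E) 1 := by
      rw [mem_sphere_zero_iff_norm, norm_smul, norm_inv, norm_norm]
      exact inv_mul_cancel₀ (norm_ne_zero_iff.2 ha)
    obtain ⟨x, hx, hax⟩ := Set.mem_iUnion₂.1 (hcov hu)
    exact ⟨x, fun _ => ⟨hx, by simpa [dist_eq_norm] using hax⟩⟩
  choose c hc using hex
  let t' : Finset E := htf.toFinset
  refine ⟨t'.card, fun a => if h : c a ∈ t' then (t'.equivFin ⟨c a, h⟩).castSucc else Fin.last _,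
    fun a b hab => ?_⟩
  by_cases ha : a = 0
  · simp [ha]
  by_cases hb : b = 0
  · simp [hb]
  obtain ⟨hca, hca'⟩ := hc a ha
  obtain ⟨hcb, hcb'⟩ := hc b hb
  have h1 : c a ∈ t' := by simpa [t'] using hca
  have h2 : c b ∈ t' := by simpa [t'] using hcb
  simp only [h1, h2, dite_true, Fin.castSucc_inj, EmbeddingLike.apply_eq_iff_eq,
    Subtype.mk.injEq] at hab
  have hna : 0 < ‖a‖ := norm_pos_iff.2 ha
  have hnb : 0 < ‖b‖ := norm_pos_iff.2 hb
  set u := ‖a‖⁻¹ • a with hu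
  set v := ‖b‖⁻¹ • b with hv
  have hau : a = ‖a‖ • u := by rw [hu, smul_smul, mul_inv_cancel₀ hna.ne', one_smul]
  have hbv : b = ‖b‖ • v := by rw [hv, smul_smul, mul_inv_cancel₀ hnb.ne', one_smul]
  have hun : ‖u‖ = 1 := by
    rw [hu, norm_smul, norm_inv, norm_norm]; exact inv_mul_cancel₀ hna.ne'
  have hvn : ‖v‖ = 1 := by
    rw [hv, norm_smul, norm_inv, norm_norm]; exact inv_mul_cancel₀ hnb.ne'
  have huv : ‖u - v‖ ≤ 1 := by
    have : u - v = (u - c a) - (v - c b) := by rw [hab]; abel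
    rw [this]
    linarith [norm_sub_le (u - c a) (v - c b)]
  have hsq := norm_sub_sq_real u v
  have hin : 1 / 2 ≤ inner ℝ u v := by
    rw [hun, hvn] at hsq
    nlinarith [norm_nonneg (u - v)]
  have : inner ℝ a b = ‖a‖ * ‖b‖ * inner ℝ u v := by
    conv_lhs => rw [hau, hbv]
    rw [real_inner_smul_left, real_inner_smul_right]; ring
  rw [this]
  nlinarith [mul_pos hna hnb]

theorem exists_finset_card_eq_forall_le {ι : Type*} [Fintype ι] [DecidableEq ι] (f : ι → ℝ)
    (M : ℕ) (hM : M ≤ Fintype.card ι) :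
    ∃ U : Finset ι, U.card = M ∧ ∀ i ∈ U, ∀ j ∉ U, f j ≤ f i := by
  induction M with
  | zero => exact ⟨∅, by simp, by simp⟩
  | succ M ih =>
    obtain ⟨U, hU, hle⟩ := ih (by omega)
    have hne : (Uᶜ).Nonempty := by
      rw [← Finset.card_pos, Finset.card_compl]; omega
    obtain ⟨m, hm, hmax⟩ := Finset.exists_max_image Uᶜ f hne
    rw [Finset.mem_compl] at hm
    refine ⟨insert m U, by rw [Finset.card_insert_of_notMem hm, hU], ?_⟩
    intro i hi j hj
    rw [Finset.mem_insert, not_or] at hj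
    rcases Finset.mem_insert.1 hi with rfl | hi
    · exact hmax j (Finset.mem_compl.2 hj.2)
    · exact hle i hi j hj.2

section
variable {E : Type*} [NormedAddCommGroup E] [InnerProductSpace ℝ E]

theorem sum_offDiag_inner_eq {ι : Type*} [DecidableEq ι] (q : ι → E) (S : Finset ι) :
    ∑ x ∈ S.offDiag, inner ℝ (q x.1) (q x.2) = ‖∑ i ∈ S, q i‖ ^ 2 - ∑ i ∈ S, ‖q i‖ ^ 2 := by
  have h1 : ‖∑ i ∈ S, q i‖ ^ 2 = ∑ x ∈ S ×ˢ S, inner ℝ (q x.1) (q x.2) := by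
    rw [← real_inner_self_eq_norm_sq, sum_inner, Finset.sum_product]
    simp_rw [inner_sum]
  rw [h1, ← Finset.diag_union_offDiag, Finset.sum_union (Finset.disjoint_diag_offDiag S),
    Finset.sum_diag]
  simp_rw [real_inner_self_eq_norm_sq]
  ring

theorem half_sum_norm_le_norm_sum {ι : Type*} (q : ι → E) (S : Finset ι)
    (h : ∀ i ∈ S, ∀ j ∈ S, 1 / 2 * (‖q i‖ * ‖q j‖) ≤ inner ℝ (q i) (q j)) :
    1 / 2 * ∑ i ∈ S, ‖q i‖ ≤ ‖∑ i ∈ S, q i‖ := by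
  have hsq : 1 / 2 * (∑ i ∈ S, ‖q i‖) ^ 2 ≤ ‖∑ i ∈ S, q i‖ ^ 2 := by
    rw [← real_inner_self_eq_norm_sq, sum_inner, sq, Finset.sum_mul_sum, Finset.mul_sum]
    simp_rw [inner_sum, Finset.mul_sum]
    exact Finset.sum_le_sum fun i hi => Finset.sum_le_sum fun j hj => h i hi j hj
  have h0 : 0 ≤ ∑ i ∈ S, ‖q i‖ := Finset.sum_nonneg fun i _ => norm_nonneg _
  refine abs_le_of_sq_le_sq' ?_ (norm_nonneg _) |>.2
  nlinarith

/-- If vectors are divided into finitely many classes of nearly the same direction, then, possibly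
after deletion of one class, the norm of the sum is at least a fixed proportion of the sum of the
norms. The class to consider is the one with the largest sum of norms: its sum is long, so the sums
with and without it cannot both be short. -/
theorem exists_subset_sum_norm_le {ι κ : Type*} [DecidableEq ι] [Fintype κ] [DecidableEq κ]
    [Nonempty κ] (q : ι → E) (R : Finset ι) (col : ι → κ)
    (hcol : ∀ i ∈ R, ∀ j ∈ R, col i = col j → 1 / 2 * (‖q i‖ * ‖q j‖) ≤ inner ℝ (q i) (q j)) :
    ∃ c : κ, ∃ R' ⊆ R, (∀ i ∈ R, i ∉ R' → col i = c) ∧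
      ∑ i ∈ R, ‖q i‖ ≤ 4 * Fintype.card κ * ‖∑ i ∈ R', q i‖ := by
  obtain ⟨c, -, hc⟩ : ∃ c ∈ (Finset.univ : Finset κ), ∑ i ∈ R, ‖q i‖ ≤
      Fintype.card κ * ∑ i ∈ R with col i = c, ‖q i‖ := by
    have h0 : (0 : ℝ) < Fintype.card κ := by exact_mod_cast Fintype.card_pos
    have := Finset.exists_le_of_sum_le (s := (Finset.univ : Finset κ))
      (f := fun _ => (∑ i ∈ R, ‖q i‖) / Fintype.card κ)
      (g := fun c => ∑ i ∈ R with col i = c, ‖q i‖) Finset.univ_nonempty (by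
        rw [Finset.sum_fiberwise, Finset.sum_const, Finset.card_univ, nsmul_eq_mul,
          mul_div_cancel₀ _ h0.ne'])
    obtain ⟨c, hc, h⟩ := this
    exact ⟨c, hc, by rwa [div_le_iff₀' h0] at h⟩
  set Q := R.filter (fun i => col i = c) with hQ
  have hlow := half_sum_norm_le_norm_sum q Q (fun i hi j hj => by
    rw [hQ, Finset.mem_filter] at hi hj
    exact hcol i hi.1 j hj.1 (hi.2.trans hj.2.symm))
  have hsplit : ∑ i ∈ R, q i - ∑ i ∈ R \ Q, q i = ∑ i ∈ Q, q i := by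
    rw [← Finset.sum_sdiff (Finset.filter_subset _ R : Q ⊆ R)]; abel
  have htri : ‖∑ i ∈ Q, q i‖ ≤ ‖∑ i ∈ R, q i‖ + ‖∑ i ∈ R \ Q, q i‖ := by
    rw [← hsplit]; exact norm_sub_le _ _
  have hk : (0 : ℝ) ≤ Fintype.card κ := Nat.cast_nonneg _
  rcases le_total ‖∑ i ∈ R, q i‖ ‖∑ i ∈ R \ Q, q i‖ with h | h
  · refine ⟨c, R \ Q, Finset.sdiff_subset, fun i hi hiR => ?_, ?_⟩
    · by_contra hne
      exact hiR (Finset.mem_sdiff.2 ⟨hi, by simp [hQ, hne]⟩)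
    · refine hc.trans ?_
      have : ∑ i ∈ Q, ‖q i‖ ≤ 4 * ‖∑ i ∈ R \ Q, q i‖ := by linarith
      nlinarith
  · refine ⟨c, R, subset_rfl, fun i hi hiR => (hiR hi).elim, ?_⟩
    refine hc.trans ?_
    have : ∑ i ∈ Q, ‖q i‖ ≤ 4 * ‖∑ i ∈ R, q i‖ := by linarith
    nlinarith

/-- Let `P` consist of many vectors of length at least `α` in nearly the same direction, and `R` of
vectors of length at most `α` and of total length at most `C * α`. The positive inner products
within `P` outweigh all others, so the inner products over the pairs from `P ∪ R` have nonnegative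
sum. -/
theorem sum_offDiag_inner_nonneg_of_dominating {ι : Type*} [DecidableEq ι] (q : ι → E)
    (P R : Finset ι) (hPR : Disjoint P R) (α C : ℝ) (hα : 0 ≤ α) (hC : 0 ≤ C)
    (hP : ∀ i ∈ P, α ≤ ‖q i‖) (hR : ∀ i ∈ R, ‖q i‖ ≤ α)
    (hang : ∀ i ∈ P, ∀ j ∈ P, 1 / 2 * (‖q i‖ * ‖q j‖) ≤ inner ℝ (q i) (q j))
    (hsum : ∑ i ∈ R, ‖q i‖ ≤ C * α) (hK : 6 * C + 1 ≤ P.card) :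
    0 ≤ ∑ x ∈ (P ∪ R).offDiag, inner ℝ (q x.1) (q x.2) := by
  rw [sum_offDiag_inner_eq, Finset.sum_union hPR, Finset.sum_union hPR, norm_add_sq_real]
  have hFP : 1 / 2 * ((P.card - 1) * α) * ∑ i ∈ P, ‖q i‖ ≤
      ‖∑ i ∈ P, q i‖ ^ 2 - ∑ i ∈ P, ‖q i‖ ^ 2 := by
    rw [← sum_offDiag_inner_eq]
    have h1 : ∑ x ∈ P.offDiag, 1 / 2 * (‖q x.1‖ * α) ≤
        ∑ x ∈ P.offDiag, inner ℝ (q x.1) (q x.2) := by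
      refine Finset.sum_le_sum fun x hx => ?_
      rw [Finset.mem_offDiag] at hx
      refine le_trans ?_ (hang _ hx.1 _ hx.2.1)
      have := mul_le_mul_of_nonneg_left (hP _ hx.2.1) (norm_nonneg (q x.1))
      linarith
    refine le_trans (le_of_eq ?_) h1
    have h2 : ∑ x ∈ P ×ˢ P, 1 / 2 * (‖q x.1‖ * α) = P.card * (1 / 2 * α * ∑ i ∈ P, ‖q i‖) := by
      rw [Finset.sum_product]
      simp only [Finset.sum_const, nsmul_eq_mul]
      rw [← Finset.mul_sum]
      congr 1
      rw [Finset.mul_sum]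
      exact Finset.sum_congr rfl fun i _ => by ring
    rw [← Finset.diag_union_offDiag, Finset.sum_union (Finset.disjoint_diag_offDiag P),
      Finset.sum_diag] at h2
    have h3 : ∑ i ∈ P, 1 / 2 * (‖q i‖ * α) = 1 / 2 * α * ∑ i ∈ P, ‖q i‖ := by
      rw [Finset.mul_sum]
      exact Finset.sum_congr rfl fun i _ => by ring
    linarith
  set Y := ∑ i ∈ P, ‖q i‖ with hY
  set Z := ∑ i ∈ R, ‖q i‖ with hZ
  have hY0 : 0 ≤ Y := Finset.sum_nonneg fun _ _ => norm_nonneg _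
  have hZ0 : 0 ≤ Z := Finset.sum_nonneg fun _ _ => norm_nonneg _
  have hB : ∑ i ∈ R, ‖q i‖ ^ 2 ≤ α * Z := by
    rw [hZ, Finset.mul_sum]
    refine Finset.sum_le_sum fun i hi => ?_
    nlinarith [norm_nonneg (q i), hR i hi]
  have hYα : α ≤ Y := by
    have : P.card * α ≤ Y := by
      rw [← nsmul_eq_mul]; exact Finset.card_nsmul_le_sum _ _ _ hP
    nlinarith
  have hcross : -(Y * Z) ≤ inner ℝ (∑ i ∈ P, q i) (∑ i ∈ R, q i) := by
    have h1 := abs_real_inner_le_norm (∑ i ∈ P, q i) (∑ i ∈ R, q i)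
    have h2 : ‖∑ i ∈ P, q i‖ * ‖∑ i ∈ R, q i‖ ≤ Y * Z :=
      mul_le_mul (norm_sum_le _ _) (norm_sum_le _ _) (norm_nonneg _) hY0
    linarith [neg_abs_le (inner ℝ (∑ i ∈ P, q i) (∑ i ∈ R, q i))]
  have hz2 := sq_nonneg ‖∑ i ∈ R, q i‖
  have e1 : Y * Z ≤ Y * (C * α) := mul_le_mul_of_nonneg_left hsum hY0
  have e2 : α * Z ≤ Y * (C * α) :=
    (mul_le_mul_of_nonneg_left hsum hα).trans
      (mul_le_mul_of_nonneg_right hYα (mul_nonneg hC hα))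
  have e3 : 3 * C * (α * Y) ≤ 1 / 2 * (P.card - 1) * (α * Y) :=
    mul_le_mul_of_nonneg_right (by linarith) (mul_nonneg hα hY0)
  nlinarith

end

/-- Among sufficiently many vectors of a finite-dimensional space one can discard a small proportion
so that the inner products of the pairs of remaining vectors have nonnegative sum. Let `P` be a
large set of vectors in nearly the same direction among the longest ones, and `R` the set of all but
the longest. Either a small deletion makes the sum over `R` long enough, or the vectors in `R` are
negligible against those in `P`, and `P ∪ R` will do. -/
theorem exists_large_subset_sum_offDiag_inner_nonneg (E : Type*) [NormedAddCommGroup E]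
    [InnerProductSpace ℝ E] [FiniteDimensional ℝ E] (η : ℝ) (hη : 0 < η) :
    ∃ s₀ : ℕ, ∀ s : ℕ, s₀ ≤ s → ∀ q : Fin s → E, ∃ S : Finset (Fin s),
      (1 - η) * s ≤ S.card ∧ 0 ≤ ∑ x ∈ S.offDiag, inner ℝ (q x.1) (q x.2) := by
  classical
  obtain ⟨T, col, hcol⟩ := exists_finite_direction_coloring E
  obtain ⟨N, hN⟩ := exists_nat_gt (2 / η)
  have hN0 : (0 : ℝ) < N := (by positivity : (0 : ℝ) < 2 / η).trans hN
  have hNpos : 0 < N := by exact_mod_cast hN0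
  have : NeZero N := ⟨hNpos.ne'⟩
  set D : ℝ := 4 * Fintype.card (Fin (T + 1) × Fin N) with hD
  obtain ⟨K, hK⟩ := exists_nat_gt (6 * D ^ 2 + 1)
  have hK1 : 1 ≤ K := by
    have : (1 : ℝ) ≤ K := by nlinarith [sq_nonneg D]
    exact_mod_cast this
  set M : ℕ := (T + 1) * K with hM
  obtain ⟨s₀, hs₀⟩ := exists_nat_gt (2 * (M + 1) / η)
  refine ⟨max s₀ M, fun s hs q => ?_⟩
  have hsM : M ≤ s := (le_max_right _ _).trans hs
  have hss : (M : ℝ) + 1 ≤ η / 2 * s := by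
    have h1 : (s₀ : ℝ) ≤ s := by exact_mod_cast (le_max_left _ _).trans hs
    have h2 : 2 * (M + 1) / η ≤ s := hs₀.le.trans h1
    rw [div_le_iff₀ hη] at h2
    linarith
  obtain ⟨U, hUM, hU⟩ := exists_finset_card_eq_forall_le (fun i => ‖q i‖) M (by simpa using hsM)
  -- a large set of vectors in `U` that point in nearly the same direction
  obtain ⟨c, -, hcK⟩ := Finset.exists_le_card_fiber_of_mul_le_card_of_maps_to
    (s := U) (t := (Finset.univ : Finset (Fin (T + 1)))) (f := fun i => col (q i)) (n := K)
    (fun _ _ => Finset.mem_univ _) Finset.univ_nonempty (by simp [hUM, hM])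
  set P := U.filter (fun i => col (q i) = c) with hP
  have hang : ∀ i ∈ P, ∀ j ∈ P, 1 / 2 * (‖q i‖ * ‖q j‖) ≤ inner ℝ (q i) (q j) := by
    intro i hi j hj
    rw [hP, Finset.mem_filter] at hi hj
    exact hcol _ _ (hi.2.trans hj.2.symm)
  have hPne : P.Nonempty := Finset.card_pos.1 (by omega)
  obtain ⟨m, hmP, hmin⟩ := Finset.exists_min_image P (fun i => ‖q i‖) hPne
  have hmU : m ∈ U := (Finset.mem_filter.1 hmP).1
  set R := Uᶜ with hR
  have hRcard : (R.card : ℝ) = s - M := by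
    have : R.card = s - M := by rw [hR, Finset.card_compl, Fintype.card_fin, hUM]
    rw [this, Nat.cast_sub hsM]
  have hRα : ∀ i ∈ R, ‖q i‖ ≤ ‖q m‖ := fun i hi => hU m hmU i (Finset.mem_compl.1 hi)
  -- the classes combine the direction with the residue of the index, which makes them small
  obtain ⟨d, R', hR'R, hR'd, hR'⟩ := exists_subset_sum_norm_le q R
    (fun i => ((col (q i), (Fin.ofNat N i.val : Fin N)) : Fin (T + 1) × Fin N))
    (fun i _ j _ hij => hcol _ _ (congrArg Prod.fst hij))
  rw [← hD] at hR'
  have hdel : ((R \ R').card : ℝ) ≤ s / N + 1 := by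
    have hsub : (R \ R').card ≤ ((Finset.range s).filter (fun i => i ≡ d.2.val [MOD N])).card := by
      refine Finset.card_le_card_of_injOn (fun i => i.val) (fun i hi => ?_)
        (Fin.val_injective.injOn)
      have hi' := Finset.mem_sdiff.1 hi
      have := congrArg (fun x => (Prod.snd x).val) (hR'd i hi'.1 hi'.2)
      simp only [Fin.ofNat] at this
      simp only [Finset.coe_filter, Finset.mem_range, Set.mem_ofPred_eq]
      refine ⟨i.isLt, ?_⟩
      rw [Nat.ModEq, this, Nat.mod_eq_of_lt d.2.isLt]
    have hcount : ((Finset.range s).filter (fun i => i ≡ d.2.val [MOD N])).card ≤ s / N + 1 := by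
      rw [← Nat.count_eq_card_filter_range, Nat.count_modEq_card _ hNpos]
      split_ifs <;> omega
    have : ((R \ R').card : ℝ) ≤ ((s / N + 1 : ℕ) : ℝ) := by exact_mod_cast hsub.trans hcount
    refine this.trans ?_
    push_cast
    have := @Nat.cast_div_le ℝ _ _ _ s N
    linarith
  have hsN : (s : ℝ) / N ≤ η / 2 * s := by
    rw [div_le_iff₀ hN0]
    have h1 : 2 < N * η := by rwa [div_lt_iff₀ hη] at hN
    have h2 : (0 : ℝ) ≤ s := Nat.cast_nonneg _
    nlinarith
  by_cases hcase : 0 ≤ ∑ x ∈ R'.offDiag, inner ℝ (q x.1) (q x.2)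
  · refine ⟨R', ?_, hcase⟩
    have h1 : ((R \ R').card : ℝ) + R'.card = R.card := by
      exact_mod_cast Finset.card_sdiff_add_card_eq_card hR'R
    linarith
  · refine ⟨P ∪ R, ?_, ?_⟩
    · have h1 : (R.card : ℝ) ≤ (P ∪ R).card := by
        exact_mod_cast Finset.card_le_card Finset.subset_union_right
      nlinarith [(Nat.cast_nonneg s : (0 : ℝ) ≤ s)]
    · rw [sum_offDiag_inner_eq, not_le] at hcase
      set Z := ∑ i ∈ R, ‖q i‖ with hZ
      have hZ0 : 0 ≤ Z := Finset.sum_nonneg fun _ _ => norm_nonneg _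
      have hB : ∑ i ∈ R', ‖q i‖ ^ 2 ≤ ‖q m‖ * Z := by
        calc ∑ i ∈ R', ‖q i‖ ^ 2 ≤ ∑ i ∈ R, ‖q i‖ ^ 2 :=
              Finset.sum_le_sum_of_subset_of_nonneg hR'R fun _ _ _ => sq_nonneg _
          _ ≤ ‖q m‖ * Z := by
              rw [hZ, Finset.mul_sum]
              refine Finset.sum_le_sum fun i hi => ?_
              nlinarith [norm_nonneg (q i), hRα i hi]
      have hD0 : 0 ≤ D := by positivity
      have hZZ : Z ≤ D ^ 2 * ‖q m‖ := by
        have h1 : Z ^ 2 ≤ D ^ 2 * ‖∑ i ∈ R', q i‖ ^ 2 := by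
          rw [← mul_pow]; exact pow_le_pow_left₀ hZ0 hR' 2
        have h2 : Z * Z ≤ D ^ 2 * ‖q m‖ * Z := by nlinarith [sq_nonneg D]
        rcases hZ0.eq_or_lt with h | h
        · rw [← h]; positivity
        · exact le_of_mul_le_mul_right h2 h
      refine sum_offDiag_inner_nonneg_of_dominating q P R ?_ ‖q m‖ (D ^ 2) (norm_nonneg _)
        (sq_nonneg _) hmin hRα hang hZZ ?_
      · rw [hR]
        exact Finset.disjoint_left.2 fun i hi hi' =>
          (Finset.mem_compl.1 hi') (Finset.mem_filter.1 hi).1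
      · exact hK.le.trans (by exact_mod_cast hcK)

/-! ### Weighted graphs close to the bound of Turán's theorem -/

open Classical in
/-- The total weight of the neighbours of `u` that lie in `X`. -/
noncomputable def weightedDegree {V : Type*} (G : SimpleGraph V) (w : V → ℝ) (X : Finset V)
    (u : V) : ℝ :=
  ∑ v ∈ X with G.Adj u v, w v

section
variable {V : Type*} {G : SimpleGraph V} {w : V → ℝ}

theorem weightedDegree_nonneg (hw : ∀ v, 0 ≤ w v) (X : Finset V) (u : V) :
    0 ≤ weightedDegree G w X u :=
  Finset.sum_nonneg fun v _ => hw v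

theorem weightedDegree_mono (hw : ∀ v, 0 ≤ w v) {X Y : Finset V} (h : X ⊆ Y) (u : V) :
    weightedDegree G w X u ≤ weightedDegree G w Y u := by
  classical
  exact Finset.sum_le_sum_of_subset_of_nonneg (Finset.filter_subset_filter _ h) fun v _ _ => hw v

theorem weightedDegree_le_sum (hw : ∀ v, 0 ≤ w v) (X : Finset V) (u : V) :
    weightedDegree G w X u ≤ ∑ v ∈ X, w v := by
  classical
  exact Finset.sum_le_sum_of_subset_of_nonneg (Finset.filter_subset _ _) fun v _ _ => hw v

theorem weightedDegree_add_sdiff [DecidableEq V] {X Y : Finset V} (h : Y ⊆ X) (u : V) :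
    weightedDegree G w Y u + weightedDegree G w (X \ Y) u = weightedDegree G w X u := by
  classical
  simp only [weightedDegree, Finset.sum_filter]
  rw [add_comm, Finset.sum_sdiff h]

theorem sum_weight_mul_weightedDegree_comm (X Y : Finset V) :
    ∑ u ∈ X, w u * weightedDegree G w Y u = ∑ v ∈ Y, w v * weightedDegree G w X v := by
  classical
  simp only [weightedDegree, Finset.sum_filter, Finset.mul_sum]
  rw [Finset.sum_comm]
  refine Finset.sum_congr rfl fun v _ => Finset.sum_congr rfl fun u _ => ?_
  simp only [G.adj_comm u v]
  split_ifs <;> ring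

/-- The weighted form of Turán's theorem: if `X` spans no clique on `r + 1` vertices, then the
ordered adjacent pairs in `X` have total weight at most `1 - 1 / r` times the square of the weight
of `X`. -/
theorem weighted_turan (hw : ∀ v, 0 ≤ w v) (r : ℕ) : ∀ X : Finset V,
    (∀ t ⊆ X, ¬ G.IsNClique (r + 1) t) →
    r * ∑ u ∈ X, w u * weightedDegree G w X u ≤ (r - 1) * (∑ u ∈ X, w u) ^ 2 := by
  classical
  induction r with
  | zero =>
    intro X hX
    have : X = ∅ := by
      by_contra hne
      obtain ⟨x, hx⟩ := Finset.nonempty_iff_ne_empty.2 hne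
      exact hX {x} (by simpa using hx) (by simp [SimpleGraph.isNClique_iff])
    simp [this]
  | succ r ih =>
    intro X hX
    rcases X.eq_empty_or_nonempty with rfl | hne
    · simp
    -- the neighbours of a vertex of maximum degree span no clique on `r + 1` vertices
    obtain ⟨v, hv, hmax⟩ := Finset.exists_max_image X (weightedDegree G w X) hne
    set N := X.filter (fun u => G.Adj v u) with hN
    set D := weightedDegree G w X v with hD
    have hND : ∑ u ∈ N, w u = D := rfl
    have hNX : N ⊆ X := Finset.filter_subset _ _
    have ihN := ih N (fun t ht hcl => by
      refine hX (insert v t) (Finset.insert_subset hv (ht.trans hNX)) (hcl.insert ?_)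
      intro b hb
      exact (Finset.mem_filter.1 (ht hb)).2)
    rw [hND] at ihN
    set W := ∑ u ∈ X, w u with hW
    have hWD : ∑ u ∈ X \ N, w u = W - D := by
      rw [← hND, hW, ← Finset.sum_sdiff hNX]; ring
    have hout : ∑ u ∈ X \ N, w u * weightedDegree G w X u ≤ (W - D) * D := by
      rw [← hWD, Finset.sum_mul]
      exact Finset.sum_le_sum fun u hu =>
        mul_le_mul_of_nonneg_left (hmax u (Finset.mem_sdiff.1 hu).1) (hw u)
    have hin : ∑ u ∈ N, w u * weightedDegree G w X u ≤
        ∑ u ∈ N, w u * weightedDegree G w N u + (W - D) * D := by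
      have : ∑ u ∈ N, w u * weightedDegree G w X u = ∑ u ∈ N, w u * weightedDegree G w N u +
          ∑ u ∈ N, w u * weightedDegree G w (X \ N) u := by
        rw [← Finset.sum_add_distrib]
        refine Finset.sum_congr rfl fun u _ => ?_
        rw [← weightedDegree_add_sdiff hNX u]; ring
      rw [this, sum_weight_mul_weightedDegree_comm N (X \ N)]
      refine add_le_add le_rfl (le_trans ?_ hout)
      exact Finset.sum_le_sum fun u _ =>
        mul_le_mul_of_nonneg_left (weightedDegree_mono hw hNX u) (hw u)
    have hsum : ∑ u ∈ X, w u * weightedDegree G w X u ≤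
        ∑ u ∈ N, w u * weightedDegree G w N u + 2 * ((W - D) * D) := by
      rw [← Finset.sum_sdiff hNX]; linarith
    rcases Nat.eq_zero_or_pos r with rfl | hr
    · have hle : ∑ u ∈ X, w u * weightedDegree G w X u ≤ W * D := by
        rw [hW, Finset.sum_mul]
        exact Finset.sum_le_sum fun u hu => mul_le_mul_of_nonneg_left (hmax u hu) (hw u)
      have hD0 : D = 0 := by
        norm_num at ihN
        exact ihN
      rw [hD0] at hle
      norm_num
      linarith
    · have hr' : (1 : ℝ) ≤ r := by exact_mod_cast hr
      push_cast
      set e := ∑ u ∈ X, w u * weightedDegree G w X u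
      set e' := ∑ u ∈ N, w u * weightedDegree G w N u
      have key : r * ((r + 1) * e) ≤ r * ((r + 1 - 1) * W ^ 2) := by
        have h1 : r * ((r + 1) * e) ≤ (r + 1) * (r * e' + r * (2 * ((W - D) * D))) := by
          have := mul_le_mul_of_nonneg_left hsum (by positivity : (0 : ℝ) ≤ r * (r + 1))
          linarith
        have h2 : (r + 1) * (r * e' + r * (2 * ((W - D) * D))) ≤
            (r + 1) * ((r - 1) * D ^ 2 + r * (2 * ((W - D) * D))) := by gcongr
        nlinarith [sq_nonneg (r * W - (r + 1) * D)]
      exact le_of_mul_le_mul_left key (by linarith)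

/-- If every vertex of a set `I a` is adjacent to all but weight `β` of each other set `I b`, then a
clique extends greedily by one vertex from each set in which enough weight is left. -/
theorem exists_isNClique_of_transversal [DecidableEq V] {κ : Type*} [DecidableEq κ]
    (I : κ → Finset V) (β : ℝ)
    (hβ : 0 ≤ β) (hI : ∀ a b, a ≠ b → ∀ x ∈ I a,
      ∑ v ∈ I b, w v - weightedDegree G w (I b) x ≤ β) (J : Finset κ) (hw : ∀ v, 0 ≤ w v) :
    ∀ (t : Finset V) (n : ℕ) (I' : κ → Finset V), G.IsNClique n t → (∀ b ∈ J, I' b ⊆ I b) →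
      (∀ b ∈ J, ∀ x ∈ I' b, ∀ y ∈ t, G.Adj x y) → (∀ b ∈ J, J.card * β < ∑ v ∈ I' b, w v) →
      ∃ t', G.IsNClique (n + J.card) t' := by
  classical
  induction J using Finset.induction_on with
  | empty => exact fun t n _ ht _ _ _ => ⟨t, by simpa using ht⟩
  | insert a J ha ih =>
    intro t n I' ht hsub hadj hwt
    rw [Finset.card_insert_of_notMem ha] at hwt ⊢
    push_cast at hwt
    have hpos : ∑ v ∈ I' a, w v ≠ 0 := by
      have := hwt a (Finset.mem_insert_self _ _)
      have h2 : 0 ≤ ((J.card : ℝ) + 1) * β := by positivity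
      linarith
    obtain ⟨x, hx, -⟩ := Finset.exists_ne_zero_of_sum_ne_zero hpos
    have hxa : x ∈ I a := hsub a (Finset.mem_insert_self _ _) hx
    obtain ⟨t', ht'⟩ := ih (insert x t) (n + 1) (fun b => (I' b).filter (fun v => G.Adj x v))
      (ht.insert fun b hb => hadj a (Finset.mem_insert_self _ _) x hx b hb)
      (fun b hb => (Finset.filter_subset _ _).trans (hsub b (Finset.mem_insert_of_mem hb)))
      (fun b hb y hy z hz => by
        rw [Finset.mem_filter] at hy
        rcases Finset.mem_insert.1 hz with rfl | hz
        · exact hy.2.symm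
        · exact hadj b (Finset.mem_insert_of_mem hb) y hy.1 z hz)
      (fun b hb => by
        have hab : a ≠ b := fun h => ha (h ▸ hb)
        have h1 := hI a b hab x hxa
        have h2 := hwt b (Finset.mem_insert_of_mem hb)
        have hsubb := hsub b (Finset.mem_insert_of_mem hb)
        have h3 := weightedDegree_add_sdiff (G := G) (w := w) hsubb x
        have h4 := weightedDegree_le_sum (G := G) hw (I b \ I' b) x
        have h5 := Finset.sum_sdiff (f := w) hsubb
        have h6 : ∑ v ∈ (I' b).filter (fun v => G.Adj x v), w v = weightedDegree G w (I' b) x := rfl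
        rw [h6]
        linarith)
    exact ⟨t', by rwa [add_assoc, add_comm 1] at ht'⟩

/-- A dense weighted graph without a clique on `r + 1` vertices has a set `X` of almost full weight
in which every vertex has nearly the largest possible degree: take `X` to maximise the weight of
its edges minus slightly less than half of `1 - 1 / r` times the square of its own weight. -/
theorem exists_subset_forall_le_weightedDegree [Fintype V]
    (hwpos : ∀ v, 0 < w v) (hw1 : ∀ v, w v ≤ 1)
    (r : ℕ) (hr : 1 ≤ r) (hG : G.CliqueFree (r + 1)) (γ : ℝ) (hγ : 0 < γ) (hγ1 : γ ≤ 1)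
    (hs : (2 / γ + 1) ^ 2 ≤ ∑ v, w v)
    (hdense : (1 - 1 / r) * ((∑ v, w v) ^ 2 - ∑ v, w v) ≤
      ∑ u, w u * weightedDegree G w Finset.univ u) :
    ∃ X : Finset V, (1 - γ) * ∑ v, w v ≤ ∑ v ∈ X, w v ∧
      ∀ v ∈ X, (1 - 1 / r - γ) * ∑ v, w v ≤ weightedDegree G w X v := by
  classical
  have hw : ∀ v, 0 ≤ w v := fun v => (hwpos v).le
  set s := ∑ v, w v with hsdef
  have hr' : (1 : ℝ) ≤ r := by exact_mod_cast hr
  have hr1 : 0 < 1 / (r : ℝ) := by positivity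
  have hr2 : 1 / (r : ℝ) ≤ 1 := by rw [div_le_one (by linarith)]; exact hr'
  have h2γ : 2 ≤ 2 / γ := by rw [le_div_iff₀ hγ]; linarith
  have hs0 : 0 < s := lt_of_lt_of_le (by positivity) hs
  set θ : ℝ := 1 - 1 / r - γ / 2 with hθ
  obtain ⟨X, -, hX⟩ := Finset.exists_max_image (Finset.univ : Finset (Finset V))
    (fun X => ∑ u ∈ X, w u * weightedDegree G w X u - θ * (∑ u ∈ X, w u) ^ 2)
    Finset.univ_nonempty
  replace hX := fun Y => hX Y (Finset.mem_univ Y)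
  set n := ∑ u ∈ X, w u with hn
  have hn0 : 0 ≤ n := Finset.sum_nonneg fun v _ => hw v
  have hns : n ≤ s := Finset.sum_le_sum_of_subset_of_nonneg (Finset.subset_univ X)
    fun v _ _ => hw v
  have hturan : ∑ u ∈ X, w u * weightedDegree G w X u ≤ (1 - 1 / r) * n ^ 2 := by
    have h1 := weighted_turan (G := G) hw r X (fun t _ ht => hG t ht)
    rw [← hn] at h1
    have h2 : (1 - 1 / (r : ℝ)) * n ^ 2 = (r - 1) * n ^ 2 / r := by field_simp
    rw [h2, le_div_iff₀ (by linarith)]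
    linarith
  have hbig : γ / 2 * (s ^ 2 - n ^ 2) ≤ s := by
    have h1 := hX Finset.univ
    rw [← hsdef] at h1
    have h2 : 0 ≤ 1 / (r : ℝ) * s := by positivity
    rw [hθ] at h1
    nlinarith
  have hsn : s - n ≤ 2 / γ := by
    rw [le_div_iff₀ hγ]
    have h1 : (s - n) * γ * s ≤ 2 * s := by
      have : 0 ≤ (s - n) * γ * n := mul_nonneg (mul_nonneg (by linarith) hγ.le) hn0
      nlinarith
    exact le_of_mul_le_mul_right h1 hs0
  have hγs : 2 / γ + 1 ≤ γ / 2 * s := by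
    have h1 : γ / 2 * (2 / γ + 1) ^ 2 ≤ γ / 2 * s := by gcongr
    have h2 : γ / 2 * (2 / γ + 1) ^ 2 = (2 / γ + 1) + γ / 2 * (2 / γ + 1) := by
      field_simp
    have h3 : 0 ≤ γ / 2 * (2 / γ + 1) := by positivity
    linarith
  refine ⟨X, by nlinarith, fun v hv => ?_⟩
  -- deleting `v` does not increase the maximised quantity
  have h1 := hX (X.erase v)
  have h2 : ∑ u ∈ X.erase v, w u = n - w v := by
    rw [hn, ← Finset.add_sum_erase X w hv]; ring
  have h3 : ∑ u ∈ X, w u * weightedDegree G w X u =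
      ∑ u ∈ X.erase v, w u * weightedDegree G w (X.erase v) u +
        2 * (w v * weightedDegree G w X v) := by
    have hsub : ({v} : Finset V) ⊆ X := by simpa using hv
    have hself : weightedDegree G w {v} v = 0 := by
      simp [weightedDegree, Finset.sum_filter]
    have hv1 := weightedDegree_add_sdiff (G := G) (w := w) hsub v
    rw [hself, zero_add, Finset.sdiff_singleton_eq_erase] at hv1
    have h4 : ∑ u ∈ X.erase v, w u * weightedDegree G w X u =
        ∑ u ∈ X.erase v, w u * weightedDegree G w {v} u +
          ∑ u ∈ X.erase v, w u * weightedDegree G w (X.erase v) u := by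
      rw [← Finset.sum_add_distrib]
      refine Finset.sum_congr rfl fun u _ => ?_
      rw [← weightedDegree_add_sdiff hsub u, Finset.sdiff_singleton_eq_erase]; ring
    rw [sum_weight_mul_weightedDegree_comm (X.erase v) {v}, Finset.sum_singleton, hv1] at h4
    rw [← Finset.add_sum_erase X _ hv]
    linarith
  simp only [h2] at h1
  have h5 : w v * (θ * (2 * n - w v)) ≤ w v * (2 * weightedDegree G w X v) := by
    rw [h3] at h1
    linarith
  have h6 := le_of_mul_le_mul_left h5 (hwpos v)
  have hv1 := hw1 v
  have hv0 := hw v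
  have h7 : (θ - γ / 2) * s = (1 - 1 / r - γ) * s := by rw [hθ]; ring
  rw [← h7]
  rcases le_or_gt 0 θ with hθ0 | hθ0
  · have hθ1 : θ ≤ 1 := by rw [hθ]; linarith
    nlinarith [mul_le_mul_of_nonneg_left hv1 hθ0, mul_nonneg hθ0 (sub_nonneg.2 hsn)]
  · have := weightedDegree_nonneg (G := G) hw X v
    nlinarith

theorem weightedDegree_le_of_disjoint [DecidableEq V] (hw : ∀ v, 0 ≤ w v) {X Y Z : Finset V}
    (hY : Y ⊆ X) (hZ : Z ⊆ X) (hYZ : Disjoint Y Z) (u : V) :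
    weightedDegree G w X u ≤ weightedDegree G w Y u + weightedDegree G w Z u +
      (∑ v ∈ X, w v - ∑ v ∈ Y, w v - ∑ v ∈ Z, w v) := by
  have hsub : Y ∪ Z ⊆ X := Finset.union_subset hY hZ
  have h1 := weightedDegree_add_sdiff (G := G) (w := w) hsub u
  have h2 := weightedDegree_le_sum (G := G) hw (X \ (Y ∪ Z)) u
  have h3 := Finset.sum_sdiff (f := w) hsub
  have h4 : weightedDegree G w (Y ∪ Z) u = weightedDegree G w Y u + weightedDegree G w Z u := by
    simp only [weightedDegree, Finset.sum_filter]
    exact Finset.sum_union hYZ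
  rw [Finset.sum_union hYZ] at h3
  linarith

/-- Inclusion and exclusion for the neighbourhoods of `u` and `v` in `Y`. -/
theorem weightedDegree_add_sub_le_sum_common [DecidableRel G.Adj] (hw : ∀ v, 0 ≤ w v)
    (Y : Finset V) (u v : V) :
    weightedDegree G w Y u + weightedDegree G w Y v - ∑ x ∈ Y, w x ≤
      ∑ x ∈ Y with G.Adj u x ∧ G.Adj v x, w x := by
  simp only [weightedDegree, Finset.sum_filter]
  rw [← Finset.sum_add_distrib, ← Finset.sum_sub_distrib]
  refine Finset.sum_le_sum fun x _ => ?_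
  have := hw x
  by_cases h1 : G.Adj u x <;> by_cases h2 : G.Adj v x <;> 
    (simp [h1, h2]; try linarith)

/-- By the weighted form of Turán's theorem, a set of large weight in which all degrees are almost
`1 - 1 / r` spans a clique on `r` vertices. -/
theorem exists_isNClique_of_le_weightedDegree (hw : ∀ v, 0 ≤ w v) (r : ℕ) (hr : 1 ≤ r)
    (X : Finset V) (s γ : ℝ) (hγ : γ ≤ 1 / 64 * (1 / r) ^ 2)
    (hn0 : 0 < ∑ v ∈ X, w v) (hns : ∑ v ∈ X, w v ≤ s)
    (hX : ∀ v ∈ X, (1 - 1 / r - γ) * s ≤ weightedDegree G w X v) :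
    ∃ Q ⊆ X, G.IsNClique r Q := by
  classical
  set n := ∑ v ∈ X, w v with hn
  by_contra hno
  push Not at hno
  obtain ⟨r', rfl⟩ : ∃ r', r = r' + 1 := ⟨r - 1, by omega⟩
  have h1 := weighted_turan (G := G) hw r' X hno
  rw [← hn] at h1
  have h2 : n * ((1 - 1 / ((r' + 1 : ℕ) : ℝ) - γ) * s) ≤
      ∑ u ∈ X, w u * weightedDegree G w X u := by
    rw [hn, Finset.sum_mul]
    exact Finset.sum_le_sum fun u hu => mul_le_mul_of_nonneg_left (hX u hu) (hw u)
  push_cast at h2 hγ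
  rcases Nat.eq_zero_or_pos r' with rfl | hr'pos
  · norm_num at h1
    nlinarith
  have hr1 : (1 : ℝ) ≤ r' := by exact_mod_cast hr'pos
  have hinv : ((r' : ℝ) + 1) * (1 / ((r' : ℝ) + 1)) = 1 := by field_simp
  have hinv0 : 0 < 1 / ((r' : ℝ) + 1) := by positivity
  set i : ℝ := 1 / ((r' : ℝ) + 1) with hi
  have hi1 : i ≤ 1 / 2 := by nlinarith
  have h3 : γ ≤ 1 / 64 * i := by nlinarith
  have h5 : r' * (n * ((1 - i - γ) * n)) ≤ (r' - 1) * n ^ 2 := by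
    refine le_trans ?_ h1
    refine mul_le_mul_of_nonneg_left (le_trans ?_ h2) (by linarith)
    have h4 : 0 ≤ 1 - i - γ := by linarith
    gcongr
  have h6 : n ^ 2 * (r' * (1 - i - γ)) ≤ n ^ 2 * (r' - 1) := by linarith
  have h7 := le_of_mul_le_mul_left h6 (by positivity)
  have h8 : r' * γ ≤ 1 / 64 * i := by
    have : r' * i ≤ 1 := by linarith
    nlinarith
  nlinarith

/-- The common neighbourhoods of all but one vertex of a clique on `r` vertices, when all degrees are
large and there is no larger clique: they are disjoint independent sets of weight almost `1 / r`
each, and between any two of them almost all edges are present. -/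
theorem exists_independent_sets_of_isNClique [DecidableEq V] (hw : ∀ v, 0 ≤ w v) (r : ℕ)
    (hr : 1 ≤ r)
    (hG : G.CliqueFree (r + 1)) (X Q : Finset V) (hQX : Q ⊆ X) (hQ : G.IsNClique r Q) (s γ : ℝ)
    (hXn : (1 - γ) * s ≤ ∑ v ∈ X, w v) (hns : ∑ v ∈ X, w v ≤ s)
    (hX : ∀ v ∈ X, (1 - 1 / r - γ) * s ≤ weightedDegree G w X v) :
    ∃ I : Fin r → Finset V, (∀ a b, a ≠ b → Disjoint (I a) (I b)) ∧
      (∀ a, (1 / r - r * γ) * s ≤ ∑ v ∈ I a, w v) ∧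
      ∀ a b, a ≠ b → ∀ x ∈ I a,
        ∑ v ∈ I b, w v - weightedDegree G w (I b) x ≤ (r + 1) * γ * s := by
  classical
  have hr' : (1 : ℝ) ≤ r := by exact_mod_cast hr
  have hr0 : (0 : ℝ) < r := by linarith
  set n := ∑ v ∈ X, w v with hn
  set f : Fin r → V := fun a => ((Q.equivFinOfCardEq hQ.card_eq).symm a : V) with hf
  have hfX : ∀ a, f a ∈ X := fun a => hQX (Subtype.coe_prop _)
  have hfinj : Function.Injective f :=
    Subtype.val_injective.comp (Equiv.injective _)
  have hfadj : ∀ a b, a ≠ b → G.Adj (f a) (f b) := fun a b hab =>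
    hQ.isClique (Subtype.coe_prop _) (Subtype.coe_prop _) (hfinj.ne hab)
  have hfQ : ∀ J : Finset (Fin r), G.IsNClique J.card (J.image f) := by
    intro J
    refine ⟨?_, Finset.card_image_of_injective _ hfinj⟩
    intro x hx y hy hxy
    obtain ⟨a, -, rfl⟩ := Finset.mem_image.1 hx
    obtain ⟨b, -, rfl⟩ := Finset.mem_image.1 hy
    exact hfadj a b fun h => hxy (h ▸ rfl)
  set I : Fin r → Finset V := fun a => X.filter (fun v => ∀ b, b ≠ a → G.Adj (f b) v) with hI
  have hIX : ∀ a, I a ⊆ X := fun a => Finset.filter_subset _ _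
  have hIdisj : ∀ a b, a ≠ b → Disjoint (I a) (I b) := by
    intro a b hab
    rw [Finset.disjoint_left]
    intro v hva hvb
    have h1 := (Finset.mem_filter.1 hva).2
    have h2 := (Finset.mem_filter.1 hvb).2
    have h3 := (hfQ Finset.univ).insert (a := v) (fun x hx => by
      obtain ⟨c, -, rfl⟩ := Finset.mem_image.1 hx
      by_cases hc : c = a
      · exact (h2 c (hc ▸ hab)).symm
      · exact (h1 c hc).symm)
    rw [Finset.card_univ, Fintype.card_fin] at h3
    exact hG _ h3
  have hIindep : ∀ a, ∀ x ∈ I a, ∀ y ∈ I a, ¬ G.Adj x y := by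
    intro a x hx y hy hxy
    have h1 := (Finset.mem_filter.1 hx).2
    have h2 := (Finset.mem_filter.1 hy).2
    have h3 := (hfQ (Finset.univ.erase a)).insert (a := y) (fun z hz => by
      obtain ⟨c, hc, rfl⟩ := Finset.mem_image.1 hz
      exact (h2 c (Finset.ne_of_mem_erase hc)).symm)
    have h4 := h3.insert (a := x) (fun z hz => by
      rcases Finset.mem_insert.1 hz with rfl | hz
      · exact hxy
      · obtain ⟨c, hc, rfl⟩ := Finset.mem_image.1 hz
        exact (h1 c (Finset.ne_of_mem_erase hc)).symm)
    rw [Finset.card_erase_of_mem (Finset.mem_univ _), Finset.card_univ, Fintype.card_fin,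
      Nat.sub_add_cancel hr] at h4
    exact hG _ h4
  have hIw : ∀ a, (1 / r - r * γ) * s ≤ ∑ v ∈ I a, w v := by
    intro a
    have h1 : ∑ v ∈ X \ I a, w v ≤
        ∑ b ∈ Finset.univ.erase a, ∑ v ∈ X with ¬ G.Adj (f b) v, w v := by
      simp only [Finset.sum_filter]
      rw [Finset.sum_comm]
      refine le_trans ?_ (Finset.sum_le_sum_of_subset_of_nonneg (Finset.sdiff_subset (t := I a))
        fun v _ _ => Finset.sum_nonneg fun b _ => by split_ifs <;> simp [hw v])
      refine Finset.sum_le_sum fun v hv => ?_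
      rw [Finset.mem_sdiff, hI, Finset.mem_filter] at hv
      obtain ⟨hvX, hv2⟩ := hv
      have : ∃ b, b ≠ a ∧ ¬ G.Adj (f b) v := by
        by_contra hcon
        push Not at hcon
        exact hv2 ⟨hvX, hcon⟩
      obtain ⟨b, hba, hb⟩ := this
      refine le_trans (le_of_eq ?_) (Finset.single_le_sum (fun c _ => ?_)
        (Finset.mem_erase.2 ⟨hba, Finset.mem_univ b⟩))
      · simp [hb]
      · split_ifs <;> simp [hw v]
    have h2 : ∀ b ∈ Finset.univ.erase a, ∑ v ∈ X with ¬ G.Adj (f b) v, w v ≤ (1 / r + γ) * s := by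
      intro b _
      have h3 : weightedDegree G w X (f b) + ∑ v ∈ X with ¬ G.Adj (f b) v, w v = n :=
        Finset.sum_filter_add_sum_filter_not _ _ _
      have h4 := hX (f b) (hfX b)
      nlinarith
    have h5 := h1.trans (Finset.sum_le_card_nsmul _ _ _ h2)
    rw [Finset.card_erase_of_mem (Finset.mem_univ _), Finset.card_univ, Fintype.card_fin,
      nsmul_eq_mul, Nat.cast_sub hr, Nat.cast_one] at h5
    have h6 := Finset.sum_sdiff (f := w) (hIX a)
    have h7 : ((r : ℝ) - 1) * ((1 / r + γ) * s) = (1 - 1 / r + r * γ - γ) * s := by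
      field_simp; ring
    rw [h7] at h5
    linarith
  refine ⟨I, hIdisj, hIw, ?_⟩
  · intro a b hab x hx
    have h1 := weightedDegree_le_of_disjoint (G := G) hw (hIX a) (hIX b) (hIdisj a b hab) x
    have h2 : weightedDegree G w (I a) x = 0 := by
      rw [weightedDegree, Finset.filter_false_of_mem (fun y hy => hIindep a x hx y hy),
        Finset.sum_empty]
    have h3 := hX x (hIX a hx)
    have h4 := hIw a
    rw [← hn, h2] at h1
    nlinarith

/-- A weighted graph without a clique on `r + 1` vertices whose edge density is almost `1 - 1 / r`
has no vertex of much larger degree, and its vertices of not much smaller degree are properly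
coloured by `r` colours. A clique on `r` vertices among vertices of large degree determines `r`
independent sets of weight almost `1 / r` each, namely the common neighbourhoods of all but one of
its vertices. Since there is no larger clique, every vertex has few neighbours in one of these sets,
which gives its colour. -/
theorem exists_coloring_of_dense [Fintype V] (hwpos : ∀ v, 0 < w v)
    (hw1 : ∀ v, w v ≤ 1) (r : ℕ) (hr : 1 ≤ r) (hG : G.CliqueFree (r + 1))
    (hs : (384 * (r : ℝ) ^ 4 + 1) ^ 2 ≤ ∑ v, w v)
    (hdense : (1 - 1 / r) * ((∑ v, w v) ^ 2 - ∑ v, w v) ≤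
      ∑ u, w u * weightedDegree G w Finset.univ u) :
    ∃ cls : V → Fin r,
      (∀ u, weightedDegree G w Finset.univ u ≤
        (1 - 1 / r + 1 / (64 * (r : ℝ) ^ 2)) * ∑ v, w v) ∧
      ∀ u v, cls u = cls v →
        (1 - 1 / r - 1 / (4 * (r : ℝ))) * ∑ v, w v ≤ weightedDegree G w Finset.univ u →
        (1 - 1 / r - 1 / (4 * (r : ℝ))) * ∑ v, w v ≤ weightedDegree G w Finset.univ v →
        ¬ G.Adj u v := by
  classical
  have hw : ∀ v, 0 ≤ w v := fun v => (hwpos v).le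
  have hr' : (1 : ℝ) ≤ r := by exact_mod_cast hr
  have hr0 : (0 : ℝ) < r := by linarith
  set γ : ℝ := 1 / (192 * (r : ℝ) ^ 4) with hγ
  have hγ0 : 0 < γ := by positivity
  have hr4 : (1 : ℝ) ≤ (r : ℝ) ^ 4 := one_le_pow₀ hr'
  have hγ1 : γ ≤ 1 := by rw [hγ, div_le_one (by positivity)]; linarith
  have h2γ : 2 / γ = 384 * (r : ℝ) ^ 4 := by rw [hγ]; field_simp; norm_num
  obtain ⟨X, hXn, hX⟩ := exists_subset_forall_le_weightedDegree (G := G) hwpos hw1 r hr hG γ hγ0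
    hγ1 (by rwa [h2γ]) hdense
  set s := ∑ v, w v with hsdef
  have hs0 : 0 < s := lt_of_lt_of_le (by positivity) hs
  set n := ∑ v ∈ X, w v with hn
  have hns : n ≤ s := Finset.sum_le_sum_of_subset_of_nonneg (Finset.subset_univ X)
    fun v _ _ => hw v
  have hγlt : γ < 1 := by rw [hγ, div_lt_one (by positivity)]; linarith
  have hn0 : 0 < n := lt_of_lt_of_le (mul_pos (by linarith) hs0) hXn
  -- bounds for the error terms
  have hδ : ((r : ℝ) ^ 2 + 2 * r) * γ ≤ 1 / (64 * (r : ℝ) ^ 2) := by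
    have h1 : ((r : ℝ) ^ 2 + 2 * r) * γ ≤ 3 * (r : ℝ) ^ 2 * γ := by
      refine mul_le_mul_of_nonneg_right ?_ hγ0.le
      nlinarith
    have h2 : 3 * (r : ℝ) ^ 2 * γ = 1 / (64 * (r : ℝ) ^ 2) := by
      rw [hγ]; field_simp; norm_num
    linarith
  have hδ' : 1 / (64 * (r : ℝ) ^ 2) ≤ 1 / 64 * (1 / r) := by
    rw [div_mul_div_comm, one_mul]
    refine one_div_le_one_div_of_le (by positivity) ?_
    nlinarith
  obtain ⟨Q, hQX, hQ⟩ := exists_isNClique_of_le_weightedDegree hw r hr X s γ (by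
    rw [hγ, one_div_pow, div_mul_div_comm, one_mul]
    refine one_div_le_one_div_of_le (by positivity) ?_
    nlinarith [sq_nonneg ((r : ℝ) ^ 2 - 1)]) hn0 hns hX
  obtain ⟨I, hIdisj, hIw, hImiss⟩ :=
    exists_independent_sets_of_isNClique hw r hr hG X Q hQX hQ s γ hXn hns hX
  set β : ℝ := (r + 1) * γ * s with hβ
  have hβ0 : 0 ≤ β := by positivity
  have hcls : ∀ u, ∃ a, weightedDegree G w (I a) u ≤ r * β := by
    intro u
    by_contra hcon
    push Not at hcon
    obtain ⟨t, ht⟩ := exists_isNClique_of_transversal (G := G) I β hβ0 hImiss Finset.univ hw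
      {u} 1 (fun a => (I a).filter (fun v => G.Adj u v))
      (by simp [SimpleGraph.isNClique_iff])
      (fun b _ => Finset.filter_subset _ _)
      (fun b _ x hx y hy => by
        rw [Finset.mem_singleton] at hy
        rw [hy]
        exact (Finset.mem_filter.1 hx).2.symm)
      (fun b _ => by
        rw [Finset.card_univ, Fintype.card_fin]
        exact hcon b)
    rw [Finset.card_univ, Fintype.card_fin, add_comm] at ht
    exact hG t ht
  choose cls hcls using hcls
  have hrβ : r * β = (r ^ 2 + r) * γ * s := by rw [hβ]; ring
  refine ⟨cls, fun u => ?_, fun u v huv hu hv hadj => ?_⟩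
  · have h1 := weightedDegree_le_of_disjoint (G := G) hw (Finset.subset_univ (I (cls u)))
      (Finset.subset_univ ∅) (Finset.disjoint_empty_right _) u
    have h2 : weightedDegree G w ∅ u = 0 := by simp [weightedDegree]
    rw [h2, ← hsdef, Finset.sum_empty] at h1
    have h3 := hIw (cls u)
    have h4 := hcls u
    have h5 := mul_le_mul_of_nonneg_right hδ hs0.le
    linarith
  · set a := cls u with ha
    have hmiss : ∀ x, cls x = a →
        (1 - 1 / r - 1 / (4 * (r : ℝ))) * s ≤ weightedDegree G w Finset.univ x →
        ∀ b, a ≠ b → ∑ y ∈ I b, w y - weightedDegree G w (I b) x ≤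
          (1 / (4 * (r : ℝ)) + 1 / (64 * (r : ℝ) ^ 2)) * s := by
      intro x hxa hx b hab
      have h1 := weightedDegree_le_of_disjoint (G := G) hw (Finset.subset_univ (I a))
        (Finset.subset_univ (I b)) (hIdisj a b hab) x
      rw [← hsdef] at h1
      have h3 := hIw a
      have h4 := hcls x
      rw [hxa] at h4
      have h5 := mul_le_mul_of_nonneg_right hδ hs0.le
      linarith
    obtain ⟨t, ht⟩ := exists_isNClique_of_transversal (G := G) I β hβ0 hImiss
      (Finset.univ.erase a) hw {u, v} 2
      (fun b => (I b).filter (fun x => G.Adj u x ∧ G.Adj v x))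
      (by
        rw [SimpleGraph.isNClique_iff]
        refine ⟨?_, Finset.card_pair hadj.ne⟩
        rw [Finset.coe_pair, SimpleGraph.isClique_pair]
        exact fun _ => hadj)
      (fun b _ => Finset.filter_subset _ _)
      (fun b _ x hx y hy => by
        have h1 := (Finset.mem_filter.1 hx).2
        rcases Finset.mem_insert.1 hy with rfl | hy
        · exact h1.1.symm
        · rw [Finset.mem_singleton] at hy
          rw [hy]; exact h1.2.symm)
      (fun b hb => by
        have hab : a ≠ b := (Finset.ne_of_mem_erase hb).symm
        refine lt_of_lt_of_le ?_ (weightedDegree_add_sub_le_sum_common hw (I b) u v)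
        have h1 := hmiss u rfl hu b hab
        have h2 := hmiss v huv.symm hv b hab
        have h3 := hIw b
        rw [Finset.card_erase_of_mem (Finset.mem_univ _), Finset.card_univ, Fintype.card_fin,
          Nat.cast_sub hr, Nat.cast_one]
        have h4 : 1 / (4 * (r : ℝ)) = 1 / 4 * (1 / r) := by field_simp
        rw [h4] at h1 h2
        have h5 := mul_le_mul_of_nonneg_right hδ hs0.le
        have h6 := mul_le_mul_of_nonneg_right hδ' hs0.le
        have h7 : ((r : ℝ) - 1) * β ≤ r * β := by linarith
        have h8 : 0 < 1 / (r : ℝ) * s := by positivity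
        have h9 : 0 ≤ γ * s := by positivity
        rw [hrβ] at h7
        linarith)
    rw [Finset.card_erase_of_mem (Finset.mem_univ _), Finset.card_univ, Fintype.card_fin,
      show 2 + (r - 1) = r + 1 by omega] at ht
    exact hG t ht

end

/-! ### Densities between parts of weight one -/

section
variable {V : Type*} {G : SimpleGraph V} {w : V → ℝ}

/-- If no vertex of `Y` is adjacent to a vertex of the same class in `Z`, then the edges between `Y`
and `Z` miss at least the weight of the pairs of the same class. -/
theorem sum_weight_mul_weightedDegree_le_of_classes (hw : ∀ v, 0 ≤ w v) {r : ℕ}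
    (Y Z : Finset V) (cls : V → Fin r)
    (h : ∀ u ∈ Y, ∀ v ∈ Z, cls u = cls v → ¬ G.Adj u v) :
    ∑ u ∈ Y, w u * weightedDegree G w Z u ≤ (∑ u ∈ Y, w u) * (∑ v ∈ Z, w v) -
      ∑ a, (∑ u ∈ Y with cls u = a, w u) * (∑ v ∈ Z with cls v = a, w v) := by
  classical
  have h1 : ∑ a, (∑ u ∈ Y with cls u = a, w u) * (∑ v ∈ Z with cls v = a, w v) =
      ∑ u ∈ Y, w u * ∑ v ∈ Z with cls v = cls u, w v := by
    rw [← Finset.sum_fiberwise Y cls]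
    refine Finset.sum_congr rfl fun a _ => ?_
    rw [Finset.sum_mul]
    refine Finset.sum_congr rfl fun u hu => ?_
    rw [(Finset.mem_filter.1 hu).2]
  rw [h1, Finset.sum_mul, ← Finset.sum_sub_distrib]
  refine Finset.sum_le_sum fun u hu => ?_
  rw [← mul_sub]
  refine mul_le_mul_of_nonneg_left ?_ (hw u)
  rw [le_sub_iff_add_le, weightedDegree, Finset.sum_filter, Finset.sum_filter,
    ← Finset.sum_add_distrib]
  refine Finset.sum_le_sum fun v hv => ?_
  have := hw v
  by_cases hc : cls v = cls u
  · simp [hc, h u hu v hv hc.symm]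
  · simp only [hc, if_false, add_zero]
    split_ifs <;> simp [this]

theorem sum_part_weightedDegree [Fintype V] {s : ℕ} (C : V → Fin s) (u : V) :
    ∑ j, weightedDegree G w {v | C v = j} u = weightedDegree G w Finset.univ u := by
  classical
  simp only [weightedDegree]
  rw [← Finset.sum_fiberwise (Finset.univ.filter fun v => G.Adj u v) C]
  refine Finset.sum_congr rfl fun j _ => ?_
  rw [Finset.filter_comm]

/-- The vertices of small degree have small total weight, because no degree is much larger than the
average. -/
theorem sum_weight_le_of_small_degree [Fintype V] [DecidableEq V] (hw : ∀ v, 0 ≤ w v) (r : ℕ)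
    (hr : 1 ≤ r)
    (A : Finset V) (hs : 0 < ∑ v, w v)
    (hdense : (1 - 1 / r) * ((∑ v, w v) ^ 2 - ∑ v, w v) ≤
      ∑ u, w u * weightedDegree G w Finset.univ u)
    (hmax : ∀ u, weightedDegree G w Finset.univ u ≤
      (1 - 1 / r + 1 / (64 * (r : ℝ) ^ 2)) * ∑ v, w v)
    (hA : ∀ u ∈ A, weightedDegree G w Finset.univ u ≤
      (1 - 1 / r - 1 / (4 * (r : ℝ))) * ∑ v, w v) :
    ∑ u ∈ A, w u ≤ 1 / 16 * (1 / r) * ∑ v, w v + 4 * r := by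
  have hr' : (1 : ℝ) ≤ r := by exact_mod_cast hr
  set s := ∑ v, w v with hsdef
  set E := ∑ u ∈ A, w u with hE
  have hE0 : 0 ≤ E := Finset.sum_nonneg fun v _ => hw v
  have h1 : ∑ u ∈ A, w u * weightedDegree G w Finset.univ u ≤
      E * ((1 - 1 / r - 1 / (4 * (r : ℝ))) * s) := by
    rw [hE, Finset.sum_mul]
    exact Finset.sum_le_sum fun u hu => mul_le_mul_of_nonneg_left (hA u hu) (hw u)
  have h2 : ∑ u ∈ Aᶜ, w u * weightedDegree G w Finset.univ u ≤
      (s - E) * ((1 - 1 / r + 1 / (64 * (r : ℝ) ^ 2)) * s) := by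
    have : s - E = ∑ u ∈ Aᶜ, w u := by
      rw [hsdef, hE, ← Finset.sum_add_sum_compl A]; ring
    rw [this, Finset.sum_mul]
    exact Finset.sum_le_sum fun u _ => mul_le_mul_of_nonneg_left (hmax u) (hw u)
  rw [← Finset.sum_add_sum_compl A] at hdense
  have hi1 : 1 / (r : ℝ) ≤ 1 := by rw [div_le_one (by linarith)]; exact hr'
  have hi0 : 0 < 1 / (r : ℝ) := by positivity
  have hc : 1 / (4 * (r : ℝ)) = 1 / 4 * (1 / r) := by field_simp
  have hd : 1 / (64 * (r : ℝ) ^ 2) = 1 / 64 * (1 / r) * (1 / r) := by field_simp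
  have hinv : (r : ℝ) * (1 / r) = 1 := by field_simp
  rw [hc] at h1
  rw [hd] at h2
  set i : ℝ := 1 / r with hi
  have h3 : (E * (1 / 4 * i)) * s ≤ (1 / 64 * i * i * s + 1) * s := by
    have h4 : 0 ≤ E * (1 / 64 * i * i) * s := by positivity
    have h5 : 0 ≤ i * s := by positivity
    nlinarith
  have h6 := le_of_mul_le_mul_right h3 hs
  have h7 : (4 * r) * (E * (1 / 4 * i)) ≤ (4 * r) * (1 / 64 * i * i * s + 1) :=
    mul_le_mul_of_nonneg_left h6 (by linarith)
  have h8 : (4 * r) * (E * (1 / 4 * i)) = E * (r * i) := by ring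
  have h9 : (4 * r) * (1 / 64 * i * i * s + 1) = 1 / 16 * (r * i) * i * s + 4 * r := by ring
  rw [h8, h9, hinv] at h7
  linarith

/-- Let `p i` be a vector of class weights with sum `t i`. Its deviations from the constant vectors
have inner products that compare `∑ a, p i a * p j a` with `t i * t j / r`. -/
theorem inner_deviation {s r : ℕ} (hr : 1 ≤ r) (p : Fin s → Fin r → ℝ) (i j : Fin s) :
    inner ℝ (WithLp.toLp 2 (fun a => p i a - (∑ b, p i b) / r) : EuclideanSpace ℝ (Fin r))
      (WithLp.toLp 2 (fun a => p j a - (∑ b, p j b) / r)) =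
      ∑ a, p i a * p j a - 1 / r * ((∑ a, p i a) * ∑ a, p j a) := by
  have hr0 : (r : ℝ) ≠ 0 := by exact_mod_cast (by omega : r ≠ 0)
  simp only [PiLp.inner_apply, RCLike.inner_apply, conj_trivial]
  set t := ∑ b, p i b with ht
  set t' := ∑ b, p j b with ht'
  have : ∀ a, (p j a - t' / r) * (p i a - t / r) =
      p i a * p j a - t / r * p j a - t' / r * p i a + t * t' / r ^ 2 := by
    intro a; field_simp; ring
  simp_rw [this]
  rw [Finset.sum_add_distrib, Finset.sum_sub_distrib, Finset.sum_sub_distrib, ← Finset.mul_sum,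
    ← Finset.mul_sum, ← ht, ← ht', Finset.sum_const, Finset.card_univ, Fintype.card_fin,
    nsmul_eq_mul]
  field_simp
  ring

theorem sum_offDiag_add_swap_le {ι : Type*} [Fintype ι] [DecidableEq ι] (S : Finset ι)
    (a : ι → ι → ℝ) (ha : ∀ i j, 0 ≤ a i j) :
    ∑ x ∈ S.offDiag, (a x.1 x.2 + a x.2 x.1) ≤ 2 * ∑ i ∈ S, ∑ j, a i j := by
  have h1 : ∑ x ∈ S.offDiag, (a x.1 x.2 + a x.2 x.1) ≤ ∑ x ∈ S ×ˢ S, (a x.1 x.2 + a x.2 x.1) :=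
    Finset.sum_le_sum_of_subset_of_nonneg
      (fun x hx => by rw [Finset.mem_offDiag] at hx; exact Finset.mem_product.2 ⟨hx.1, hx.2.1⟩)
      fun x _ _ => add_nonneg (ha _ _) (ha _ _)
  have h2 : ∑ x ∈ S ×ˢ S, (a x.1 x.2 + a x.2 x.1) = 2 * ∑ i ∈ S, ∑ j ∈ S, a i j := by
    rw [Finset.sum_add_distrib, Finset.sum_product, Finset.sum_product_right]; ring
  have h3 : ∑ i ∈ S, ∑ j ∈ S, a i j ≤ ∑ i ∈ S, ∑ j, a i j :=
    Finset.sum_le_sum fun i _ =>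
      Finset.sum_le_sum_of_subset_of_nonneg (Finset.subset_univ _) fun j _ _ => ha i j
  linarith

/-- The density between two parts, in terms of the class weights of the vertices outside a set `A`
and of the degrees of the vertices in `A`. -/
theorem sum_weight_mul_weightedDegree_le_add [DecidableEq V] (hw : ∀ v, 0 ≤ w v) {r : ℕ}
    (Y Z A : Finset V) (cls : V → Fin r)
    (h : ∀ u ∉ A, ∀ v ∉ A, cls u = cls v → ¬ G.Adj u v) :
    ∑ u ∈ Y, w u * weightedDegree G w Z u ≤
      (∑ u ∈ Y \ A, w u) * (∑ v ∈ Z \ A, w v) -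
        ∑ a, (∑ u ∈ Y \ A with cls u = a, w u) * (∑ v ∈ Z \ A with cls v = a, w v) +
      (∑ u ∈ Y ∩ A, w u * weightedDegree G w Z u + ∑ v ∈ Z ∩ A, w v * weightedDegree G w Y v) := by
  have h1 := sum_weight_mul_weightedDegree_le_of_classes (G := G) hw (Y \ A) (Z \ A) cls
    (fun u hu v hv => h u (Finset.mem_sdiff.1 hu).2 v (Finset.mem_sdiff.1 hv).2)
  have h2 : ∑ u ∈ Y, w u * weightedDegree G w Z u = ∑ u ∈ Y ∩ A, w u * weightedDegree G w Z u +
      ∑ u ∈ Y \ A, w u * weightedDegree G w Z u := by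
    rw [add_comm, ← Finset.sum_sdiff (Finset.inter_subset_left : Y ∩ A ⊆ Y),
      Finset.sdiff_inter_self_left]
  have h3 : ∑ u ∈ Y \ A, w u * weightedDegree G w Z u =
      ∑ u ∈ Y \ A, w u * weightedDegree G w (Z \ A) u +
        ∑ u ∈ Y \ A, w u * weightedDegree G w (Z ∩ A) u := by
    rw [← Finset.sum_add_distrib]
    refine Finset.sum_congr rfl fun u _ => ?_
    rw [← weightedDegree_add_sdiff (Finset.inter_subset_left : Z ∩ A ⊆ Z) u,
      Finset.sdiff_inter_self_left]
    ring
  have h4 : ∑ u ∈ Y \ A, w u * weightedDegree G w (Z ∩ A) u ≤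
      ∑ v ∈ Z ∩ A, w v * weightedDegree G w Y v := by
    rw [sum_weight_mul_weightedDegree_comm]
    exact Finset.sum_le_sum fun v _ =>
      mul_le_mul_of_nonneg_left (weightedDegree_mono hw Finset.sdiff_subset v) (hw v)
  linarith

/-- The weighted form of the upper bound: in a multipartite graph with many parts of weight `1` and
without a clique on `r + 1` vertices, some pair of parts has density at most `1 - 1 / r`. If not,
the densities are summed over the pairs of parts from a suitable set `S`. On `S` the class vectors
contribute at most `1 - 1 / r` times the weight of the pairs of unexceptional vertices, while every
exceptional vertex loses more through its small degree than it could gain. -/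
theorem exists_pair_density_le (r : ℕ) (hr : 1 ≤ r) :
    ∃ s₀ : ℕ, ∀ s : ℕ, s₀ ≤ s → ∀ (V : Type) [Fintype V] (G : SimpleGraph V) (w : V → ℝ)
      (C : V → Fin s), (∀ v, 0 < w v) → (∀ i, ∑ v with C v = i, w v = 1) →
      G.CliqueFree (r + 1) →
      ∃ i j, i ≠ j ∧ ∑ u with C u = i, w u * weightedDegree G w {v | C v = j} u ≤ 1 - 1 / r := by
  classical
  have hr' : (1 : ℝ) ≤ r := by exact_mod_cast hr
  obtain ⟨s₀, hs₀⟩ := exists_large_subset_sum_offDiag_inner_nonneg (EuclideanSpace ℝ (Fin r))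
    (1 / 16 * (1 / r)) (by positivity)
  refine ⟨max s₀ ((384 * r ^ 4 + 1) ^ 2), fun s hs V _ G w C hwpos hpart hG => ?_⟩
  by_contra! hcon
  have hw : ∀ v, 0 ≤ w v := fun v => (hwpos v).le
  set part : Fin s → Finset V := fun i => {v | C v = i} with hpartdef
  have hsR : (384 * (r : ℝ) ^ 4 + 1) ^ 2 ≤ s := by exact_mod_cast (le_max_right _ _).trans hs
  have hsum : ∑ v, w v = s := by
    rw [← Finset.sum_fiberwise _ C]; simp [hpart]
  have hw1 : ∀ v, w v ≤ 1 := fun v => by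
    rw [← hpart (C v)]
    exact Finset.single_le_sum (fun u _ => hw u) (by simp)
  have hi0 : 0 < 1 / (r : ℝ) := by positivity
  have hi1 : 1 / (r : ℝ) ≤ 1 := by rw [div_le_one (by linarith)]; exact hr'
  have hdense : (1 - 1 / r) * ((∑ v, w v) ^ 2 - ∑ v, w v) ≤
      ∑ u, w u * weightedDegree G w Finset.univ u := by
    have h1 : ∑ u, w u * weightedDegree G w Finset.univ u =
        ∑ x : Fin s × Fin s, ∑ u ∈ part x.1, w u * weightedDegree G w (part x.2) u := by
      rw [Fintype.sum_prod_type, ← Finset.sum_fiberwise _ C]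
      refine Finset.sum_congr rfl fun i _ => ?_
      change _ = ∑ j, ∑ u ∈ part i, w u * weightedDegree G w (part j) u
      rw [Finset.sum_comm]
      refine Finset.sum_congr rfl fun u _ => ?_
      rw [← Finset.mul_sum, sum_part_weightedDegree]
    have h2 : ∑ x ∈ (Finset.univ : Finset (Fin s)).offDiag, (1 - 1 / (r : ℝ)) ≤
        ∑ x : Fin s × Fin s, ∑ u ∈ part x.1, w u * weightedDegree G w (part x.2) u := by
      refine le_trans (Finset.sum_le_sum fun x hx => ?_)
        (Finset.sum_le_sum_of_subset_of_nonneg (Finset.subset_univ _) fun x _ _ => ?_)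
      · exact (hcon x.1 x.2 (Finset.mem_offDiag.1 hx).2.2).le
      · exact Finset.sum_nonneg fun u _ => mul_nonneg (hw u) (weightedDegree_nonneg hw _ u)
    rw [h1]
    refine le_trans (le_of_eq ?_) h2
    rw [Finset.sum_const, Finset.offDiag_card, Finset.card_univ, Fintype.card_fin, nsmul_eq_mul,
      Nat.cast_sub (Nat.le_mul_self s), hsum]
    push_cast
    ring
  obtain ⟨cls, hmax, hcls⟩ := exists_coloring_of_dense (G := G) hwpos hw1 r hr hG
    (by rwa [hsum]) hdense
  set A : Finset V := {u | weightedDegree G w Finset.univ u <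
    (1 - 1 / r - 1 / (4 * (r : ℝ))) * ∑ v, w v} with hA
  have hAmem : ∀ u ∉ A, (1 - 1 / r - 1 / (4 * (r : ℝ))) * ∑ v, w v ≤
      weightedDegree G w Finset.univ u := fun u hu => by simpa [hA] using hu
  have hAmem' : ∀ u ∈ A, weightedDegree G w Finset.univ u ≤
      (1 - 1 / r - 1 / (4 * (r : ℝ))) * ∑ v, w v := fun u hu => (Finset.mem_filter.1 hu).2.le
  have hs1 : (1 : ℝ) ≤ s := by
    refine le_trans ?_ hsR
    exact one_le_pow₀ (by linarith [pow_nonneg (by linarith : (0 : ℝ) ≤ r) 4])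
  have hEtot := sum_weight_le_of_small_degree hw r hr A (by rw [hsum]; linarith) hdense hmax hAmem'
  rw [hsum] at hEtot hAmem'
  -- the class weights of the parts, and the weights of the exceptional vertices
  set p : Fin s → Fin r → ℝ := fun i a => ∑ u ∈ part i \ A with cls u = a, w u with hp
  set ε : Fin s → ℝ := fun i => ∑ u ∈ part i ∩ A, w u with hε
  have ht : ∀ i, ∑ a, p i a = 1 - ε i := by
    intro i
    rw [hp, Finset.sum_fiberwise, hε]
    have h1 := Finset.sum_sdiff (f := w) (Finset.inter_subset_left : part i ∩ A ⊆ part i)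
    rw [Finset.sdiff_inter_self_left, hpart i] at h1
    simp only
    linarith
  have ht' : ∀ i, ∑ u ∈ part i \ A, w u = 1 - ε i := by
    intro i
    rw [← ht i, hp, Finset.sum_fiberwise]
  obtain ⟨S, hScard, hS⟩ := hs₀ s ((le_max_left _ _).trans hs)
    (fun i => WithLp.toLp 2 (fun a => p i a - (∑ b, p i b) / r))
  simp only [inner_deviation hr] at hS
  simp only [ht] at hS
  set m : ℝ := (S.card : ℝ) with hm
  set E := ∑ i ∈ S, ε i with hE
  have hms : m ≤ s := by
    have := Finset.card_le_univ S
    rw [Fintype.card_fin] at this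
    rw [hm]
    exact_mod_cast this
  have hε0 : ∀ i, 0 ≤ ε i := fun i => Finset.sum_nonneg fun u _ => hw u
  have hE0 : 0 ≤ E := Finset.sum_nonneg fun i _ => hε0 i
  have hEle : E ≤ ∑ u ∈ A, w u := by
    have h1 : ∑ u ∈ A, w u = ∑ i, ε i := by
      rw [← Finset.sum_fiberwise A C]
      refine Finset.sum_congr rfl fun i _ => ?_
      rw [hε]
      refine Finset.sum_congr ?_ fun _ _ => rfl
      ext u
      simp [hpartdef, and_comm]
    rw [h1]
    exact Finset.sum_le_sum_of_subset_of_nonneg (Finset.subset_univ _) fun i _ _ => hε0 i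
  set a : Fin s → Fin s → ℝ := fun i j =>
    ∑ u ∈ part i ∩ A, w u * weightedDegree G w (part j) u with ha
  have ha0 : ∀ i j, 0 ≤ a i j := fun i j =>
    Finset.sum_nonneg fun u _ => mul_nonneg (hw u) (weightedDegree_nonneg hw _ u)
  have hasum : ∑ x ∈ S.offDiag, (a x.1 x.2 + a x.2 x.1) ≤
      2 * (E * ((1 - 1 / r - 1 / (4 * (r : ℝ))) * s)) := by
    refine (sum_offDiag_add_swap_le S a ha0).trans ?_
    refine mul_le_mul_of_nonneg_left ?_ (by norm_num)
    rw [hE, Finset.sum_mul]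
    refine Finset.sum_le_sum fun i _ => ?_
    rw [ha, Finset.sum_comm, hε, Finset.sum_mul]
    refine Finset.sum_le_sum fun u hu => ?_
    rw [← Finset.mul_sum, sum_part_weightedDegree]
    exact mul_le_mul_of_nonneg_left (hAmem' u (Finset.mem_inter.1 hu).2) (hw u)
  have hpair : ∀ x ∈ S.offDiag, 1 - 1 / (r : ℝ) <
      (1 - 1 / r) * ((1 - ε x.1) * (1 - ε x.2)) -
        (∑ b, p x.1 b * p x.2 b - 1 / r * ((1 - ε x.1) * (1 - ε x.2))) +
        (a x.1 x.2 + a x.2 x.1) := by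
    intro x hx
    refine (hcon x.1 x.2 (Finset.mem_offDiag.1 hx).2.2).trans_le ?_
    have h1 := sum_weight_mul_weightedDegree_le_add (G := G) hw (part x.1) (part x.2) A cls
      (fun u hu v hv huv => hcls u v huv (hAmem u hu) (hAmem v hv))
    rw [ht', ht'] at h1
    refine h1.trans (le_of_eq ?_)
    simp only [hp, ha]
    ring
  have hrs : 20 * (r : ℝ) ^ 2 ≤ s := by
    refine le_trans ?_ hsR
    have h1 : (1 : ℝ) ≤ (r : ℝ) ^ 2 := one_le_pow₀ hr'
    nlinarith [sq_nonneg ((r : ℝ) ^ 2), sq_nonneg ((r : ℝ) ^ 4)]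
  have hr4 : 4 * (r : ℝ) + 2 ≤ 5 / 16 * (1 / r) * s := by
    have h1 : 1 / (r : ℝ) * (20 * (r : ℝ) ^ 2) ≤ 1 / r * s :=
      mul_le_mul_of_nonneg_left hrs hi0.le
    have h2 : 1 / (r : ℝ) * (20 * (r : ℝ) ^ 2) = 20 * r := by field_simp
    linarith
  have hne : S.offDiag.Nonempty := by
    have h1 : 1 < m := by nlinarith
    rw [hm] at h1
    have h2 : 1 < S.card := by exact_mod_cast h1
    obtain ⟨i, hi, j, hj, hij⟩ := Finset.one_lt_card.1 h2
    exact ⟨(i, j), Finset.mem_offDiag.2 ⟨hi, hj, hij⟩⟩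
  have hlt := Finset.sum_lt_sum_of_nonempty hne hpair
  have hconst : ∑ x ∈ S.offDiag, (1 - 1 / (r : ℝ)) = (m * m - m) * (1 - 1 / r) := by
    rw [Finset.sum_const, Finset.offDiag_card, nsmul_eq_mul, Nat.cast_sub (Nat.le_mul_self _),
      Nat.cast_mul]
  rw [hconst, Finset.sum_add_distrib, Finset.sum_sub_distrib, ← Finset.mul_sum] at hlt
  have htt : ∑ x ∈ S.offDiag, (1 - ε x.1) * (1 - ε x.2) ≤ m * m - m - 2 * (m - 1) * E + E ^ 2 := by
    have h1 := sum_offDiag_inner_eq (fun i => 1 - ε i) S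
    have h2 : ∑ x ∈ S.offDiag, inner ℝ (1 - ε x.1) (1 - ε x.2) =
        ∑ x ∈ S.offDiag, (1 - ε x.1) * (1 - ε x.2) :=
      Finset.sum_congr rfl fun x _ => by simp [mul_comm]
    have h3 : ∑ i ∈ S, (1 - ε i) = m - E := by
      rw [Finset.sum_sub_distrib]; simp [hm, hE]
    have h4 : m - 2 * E ≤ ∑ i ∈ S, ‖1 - ε i‖ ^ 2 := by
      have : m - 2 * E = ∑ i ∈ S, (1 - 2 * ε i) := by
        rw [Finset.sum_sub_distrib, ← Finset.mul_sum]; simp [hm, hE]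
      rw [this]
      refine Finset.sum_le_sum fun i _ => ?_
      rw [Real.norm_eq_abs, sq_abs]
      nlinarith [sq_nonneg (ε i)]
    rw [← h2, h1, h3, Real.norm_eq_abs, sq_abs]
    nlinarith
  have hc : 1 / (4 * (r : ℝ)) = 1 / 4 * (1 / r) := by field_simp
  rw [hc] at hasum
  set i : ℝ := 1 / r with hi
  have htt' := mul_le_mul_of_nonneg_left htt (by linarith : 0 ≤ 1 - i)
  have hfin : 0 < E * ((1 - i) * (E - 2 * (m - 1) + 2 * s) - 1 / 2 * i * s) := by
    linarith
  have hbr : (1 - i) * (E - 2 * (m - 1) + 2 * s) ≤ 1 / 2 * i * s := by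
    have h1 : (1 - i) * (E - 2 * (m - 1) + 2 * s) ≤ 1 * (E - 2 * (m - 1) + 2 * s) :=
      mul_le_mul_of_nonneg_right (by linarith) (by linarith)
    linarith
  exact absurd hfin (not_lt.2 (mul_nonpos_of_nonneg_of_nonpos hE0 (by linarith)))

end

/-! ### Densities of multipartite graphs as weighted sums -/

theorem partDensity_eq_sum {V : Type*} [Fintype V] {G : SimpleGraph V} [DecidableRel G.Adj]
    {ℓ : ℕ} (C : G.Coloring (Fin ℓ)) (i j : Fin ℓ) :
    partDensity C i j = (∑ u ∈ partOf C i, (((partOf C j).filter (G.Adj u)).card : ℝ)) /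
      ((partOf C i).card * (partOf C j).card) := by
  rw [partDensity, SimpleGraph.edgeDensity_def]
  push_cast
  congr 1
  rw [SimpleGraph.interedges_def, Finset.card_filter, Finset.sum_product]
  push_cast
  refine Finset.sum_congr rfl fun u _ => ?_
  rw [Finset.card_filter]
  push_cast
  rfl

theorem partDensity_eq_sum_weight {V : Type*} [Fintype V] {G : SimpleGraph V} [DecidableRel G.Adj]
    {ℓ : ℕ} (C : G.Coloring (Fin ℓ)) (i j : Fin ℓ) :
    partDensity C i j = ∑ u with C u = i, (1 / ((partOf C (C u)).card : ℝ)) *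
      weightedDegree G (fun v => 1 / ((partOf C (C v)).card : ℝ)) {v | C v = j} u := by
  classical
  rw [partDensity_eq_sum, Finset.sum_div]
  refine Finset.sum_congr rfl fun u hu => ?_
  have hu' : C u = i := (Finset.mem_filter.1 hu).2
  have : weightedDegree G (fun v => 1 / ((partOf C (C v)).card : ℝ)) {v | C v = j} u =
      ((partOf C j).filter (G.Adj u)).card * (1 / ((partOf C j).card : ℝ)) := by
    rw [weightedDegree, ← nsmul_eq_mul, ← Finset.sum_const]
    refine Finset.sum_congr ?_ fun v hv => ?_
    · ext v; simp [partOf]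
    · rw [(Finset.mem_filter.1 (Finset.mem_filter.1 hv).1).2]
  rw [hu', this]
  rw [div_eq_mul_inv, mul_inv]
  ring

/-! ### The extremal graph and the critical density -/

/-- The tensor product of the complete graphs on `ℓ` and on `r` vertices: `(i, a)` and `(j, b)` are
adjacent if and only if `i ≠ j` and `a ≠ b`. -/
def tensorGraph (ℓ r : ℕ) : SimpleGraph (Fin ℓ × Fin r) where
  Adj u v := u.1 ≠ v.1 ∧ u.2 ≠ v.2
  symm := ⟨fun _ _ h => ⟨h.1.symm, h.2.symm⟩⟩
  loopless := ⟨fun _ h => h.1 rfl⟩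

theorem tensorGraph_cliqueFree (ℓ r : ℕ) : (tensorGraph ℓ r).CliqueFree (r + 1) := by
  have C : (tensorGraph ℓ r).Coloring (Fin r) :=
    SimpleGraph.Coloring.mk (fun v => v.2) fun h => h.2
  refine SimpleGraph.Colorable.cliqueFree (n := r) ?_ (Nat.lt_succ_self r)
  simpa using C.colorable

/-- The tensor product of the complete graphs on `ℓ` and on `r` vertices has all densities equal to
`1 - 1 / r`, so no smaller number forces a clique on `r + 1` vertices. -/
theorem le_of_forcesInPartite (ℓ r : ℕ) (hr : 1 ≤ r) (x : ℝ)
    (hx : ForcesInPartite (SimpleGraph.completeGraph (Fin (r + 1))) ℓ x) :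
    1 - 1 / (r : ℝ) ≤ x := by
  classical
  by_contra! hlt
  have hr0 : (r : ℝ) ≠ 0 := by exact_mod_cast (by omega : r ≠ 0)
  let C : (tensorGraph ℓ r).Coloring (Fin ℓ) :=
    SimpleGraph.Coloring.mk (fun v => v.1) fun h => h.1
  have hpart : ∀ i, partOf C i = {i} ×ˢ Finset.univ := by
    intro i
    ext ⟨a, b⟩
    simp only [partOf, Finset.mem_filter, Finset.mem_univ, true_and, Finset.mem_product,
      Finset.mem_singleton, and_true]
    rfl
  have hcard : ∀ i, (partOf C i).card = r := fun i => by simp [hpart]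
  refine (SimpleGraph.not_cliqueFree_iff_top_isContained _).2 (hx _ (tensorGraph ℓ r) C
    (fun i => Finset.card_pos.1 (by rw [hcard]; omega)) fun i j hij => ?_)
    (tensorGraph_cliqueFree ℓ r)
  refine hlt.trans_eq ?_
  rw [partDensity_eq_sum, hcard, hcard]
  have hdeg : ∀ u ∈ partOf C i,
      (((partOf C j).filter ((tensorGraph ℓ r).Adj u)).card : ℝ) = r - 1 := by
    intro u hu
    have hu1 : u.1 = i := by
      rw [hpart] at hu
      exact Finset.mem_singleton.1 (Finset.mem_product.1 hu).1
    have : (partOf C j).filter ((tensorGraph ℓ r).Adj u) = {j} ×ˢ Finset.univ.erase u.2 := by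
      ext ⟨a, b⟩
      rw [Finset.mem_filter, hpart]
      simp only [tensorGraph, Finset.mem_product, Finset.mem_singleton,
        Finset.mem_univ, and_true, Finset.mem_erase]
      constructor
      · rintro ⟨rfl, h⟩
        exact ⟨rfl, h.2.symm⟩
      · rintro ⟨rfl, h⟩
        exact ⟨rfl, hu1 ▸ hij.ne, h.symm⟩
    rw [this, Finset.card_product, Finset.card_singleton, one_mul,
      Finset.card_erase_of_mem (Finset.mem_univ _), Finset.card_univ, Fintype.card_fin,
      Nat.cast_sub hr, Nat.cast_one]
  rw [Finset.sum_congr rfl hdeg, Finset.sum_const, hcard, nsmul_eq_mul]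
  field_simp

theorem mainTheorem2 (k : ℕ) (hk : 2 ≤ k) :
    ∃ L : ℕ, ∀ ℓ : ℕ, L ≤ ℓ →
      IsCriticalDensity (SimpleGraph.completeGraph (Fin k)) ℓ (((k : ℝ) - 2) / ((k : ℝ) - 1)) := by
  classical
  obtain ⟨r, rfl⟩ : ∃ r, k = r + 1 := ⟨k - 1, by omega⟩
  have hr : 1 ≤ r := by omega
  have hr0 : (r : ℝ) ≠ 0 := by exact_mod_cast (by omega : r ≠ 0)
  have hval : (((r + 1 : ℕ) : ℝ) - 2) / (((r + 1 : ℕ) : ℝ) - 1) = 1 - 1 / r := by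
    push_cast
    rw [add_sub_cancel_right]
    field_simp
    ring
  obtain ⟨L, hL⟩ := exists_pair_density_le r hr
  refine ⟨L, fun ℓ hℓ => ?_⟩
  rw [hval]
  refine ⟨?_, fun x hx => le_of_forcesInPartite ℓ r hr x hx⟩
  intro V _ G _ C hne hd
  rw [← SimpleGraph.not_cliqueFree_iff_top_isContained]
  intro hG
  have hcard : ∀ i, (0 : ℝ) < (partOf C i).card := fun i => by
    exact_mod_cast Finset.card_pos.2 (hne i)
  obtain ⟨i, j, hij, hle⟩ := hL ℓ hℓ V G (fun v => 1 / ((partOf C (C v)).card : ℝ)) C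
    (fun v => one_div_pos.2 (hcard _))
    (fun i => by
      have : ∑ v with C v = i, 1 / ((partOf C (C v)).card : ℝ) =
          ∑ v ∈ partOf C i, 1 / ((partOf C i).card : ℝ) :=
        Finset.sum_congr rfl fun v hv => by rw [(Finset.mem_filter.1 hv).2]
      rw [this, Finset.sum_const, nsmul_eq_mul, mul_one_div_cancel (hcard i).ne'])
    hG
  rw [← partDensity_eq_sum_weight] at hle
  rcases hij.lt_or_gt with h | h
  · exact absurd hle (not_le.2 (hd i j h))
  · refine absurd hle (not_le.2 ?_)
    have hsymm : partDensity C i j = partDensity C j i := by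
      rw [partDensity, partDensity, SimpleGraph.edgeDensity_comm]
    rw [hsymm]
    exact hd j i h
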